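/- Theorem (Waldhausen $S_\bullet$ of an abelian category is a decomposition space). Let $\mathcal A$ be an abelian category. For a linearly ordered set $I$ let $\operatorname{Ar}(I)$ be the poset of pairs $i\le j$ in $I$, with $(i,j)\le(i',j')$ iff $i\le i'$ and $j\le j'$. A gap complex is a functor $F\colon\operatorname{Ar}(I)\to\mathcal A$ such that every $F(i,i)$ is a zero object and, for all $i\le j\le k$, the square $$\begin{array}{ccc}F(i,j)&\to&F(i,k)\\ \downarrow&&\downarrow\\ F(j,j)&\to&F(j,k)\end{array}$$ is both a pushout and a pullback (equivalently, $0\to F(i,j)\to F(i,k)\to F(j,k)\to 0$ is exact). Let $\operatorname{Gap}(I,\mathcal A)$ be the full subcategory of $\operatorname{Fun}(\operatorname{Ar}(I),\mathcal A)$ on the gap complexes, and let $S_\bullet\mathcal A$ be the simplicial groupoid sending $[n]$ to the maximal subgroupoid of $\operatorname{Gap}([n],\mathcal A)$, with simplicial operators given by restriction along $\operatorname{Ar}([m])\to\operatorname{Ar}([n])$. Then $S_\bullet\mathcal A$ is a decomposition space. That is: call a monotone map $g\colon[m]\to[n]$ active if $g(0)=0$ and $g(m)=n$, and call $f\colon[m]\to[n]$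 inert if $f(i+1)=f(i)+1$ for $0\le i<m$; then $S_\bullet\mathcal A$ sends every pushout square in the simplex category $\Delta$ of an active map along an inert map to a homotopy pullback square of groupoids. -/

import Mathlib

open CategoryTheory CategoryTheory.Limits Opposite

universe v u

namespace DecompositionSpace

/-! ### Active and inert maps of the simplex category -/

/-- A map `g : [m] ⟶ [n]` of `Δ` is *active* if it preserves end-points:
`g 0 = 0` and `g m = n`. -/
def IsActive {a b : SimplexCategory} (g : a ⟶ b) : Prop :=
  g.toOrderHom 0 = 0 ∧ g.toOrderHom (Fin.last a.len) = Fin.last b.len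

/-- A map `f : [m] ⟶ [n]` of `Δ` is *inert* if it is distance preserving:
`f (i + 1) = f i + 1` for `0 ≤ i ≤ m - 1`. -/
def IsInert {a b : SimplexCategory} (f : a ⟶ b) : Prop :=
  ∀ i : Fin a.len, (f.toOrderHom i.succ : ℕ) = (f.toOrderHom i.castSucc : ℕ) + 1

/-! ### (Homotopy) pullbacks of groupoids -/

/-- For a strictly commuting square of groupoids
```
  P --t--> M
  |        |
  l        r
  v        v
  Q --b--> N
```
the comparison functor `x ↦ (l x, t x, id)` from `P` to the homotopy pullback of `b` and `r`,
the groupoid of triples `(q, m, b q ≅ r m)`. -/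
def toHomotopyPullback {P M Q N : Grpd.{v, u}} (t : P ⟶ M) (l : P ⟶ Q) (r : M ⟶ N) (b : Q ⟶ N)
    (w : t ≫ r = l ≫ b) : (P : Type u) ⥤ CategoricalPullback (A := Q) (B := N) (C := M) b r :=
  (CategoricalPullback.CatCommSqOver.toFunctorToCategoricalPullback
    (A := Q) (B := N) (C := M) b r P).obj
    { fst := l
      snd := t
      iso := eqToIso w.symm }

/-- A strictly commuting square of groupoids is a pullback of `∞`-groupoids (that is, a homotopy
pullback) if the comparison functor to the homotopy pullback is an equivalence. -/
def IsHomotopyPullback {P M Q N : Grpd.{v, u}} (t : P ⟶ M) (l : P ⟶ Q) (r : M ⟶ N) (b : Q ⟶ N)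
    (w : t ≫ r = l ≫ b) : Prop :=
  (toHomotopyPullback t l r b w).IsEquivalence

/-- The square obtained by applying a contravariant functor to a commuting square commutes. -/
theorem map_op_comm (X : SimplexCategoryᵒᵖ ⥤ Grpd.{v, u}) {n m q p : SimplexCategory}
    {f : n ⟶ m} {g : n ⟶ q} {g' : m ⟶ p} {f' : q ⟶ p} (w : f ≫ g' = g ≫ f') :
    X.map g'.op ≫ X.map f.op = X.map f'.op ≫ X.map g.op := by
  rw [← X.map_comp, ← X.map_comp, ← op_comp, ← op_comp, w]

/-- A simplicial groupoid `X` is a *decomposition space* if for every pushout square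
```
  [n] --f--> [m]
   |          |
   g          g'
   v          v
  [q] --f'-> [p]
```
in `Δ` of an active map `g` along an inert map `f`, the square
```
  X_p --g'^*--> X_m
   |             |
  f'^*          f^*
   v             v
  X_q --g^*---> X_n
```
is a homotopy pullback of groupoids. -/
def IsDecompositionSpace (X : SimplexCategoryᵒᵖ ⥤ Grpd.{v, u}) : Prop :=
  ∀ ⦃n m q p : SimplexCategory⦄ (f : n ⟶ m) (g : n ⟶ q) (g' : m ⟶ p) (f' : q ⟶ p),
    IsInert f → IsActive g → ∀ h : IsPushout f g g' f',
      IsHomotopyPullback (X.map g'.op) (X.map f'.op) (X.map f.op) (X.map g.op)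
        (map_op_comm X h.w)

/-! ### Gap complexes -/

/-- The category of arrows of `I`: pairs `i ≤ j`, with a (unique) morphism
`(i, j) ⟶ (i', j')` iff `i ≤ i'` and `j ≤ j'`. -/
abbrev Ar (I : Type) [LinearOrder I] : Type := {p : I × I // p.1 ≤ p.2}

namespace Ar

variable {I J : Type} [LinearOrder I] [LinearOrder J]

/-- The object `(i, j)` of `Ar I`. -/
abbrev mk (i j : I) (h : i ≤ j) : Ar I := ⟨(i, j), h⟩

/-- The morphism `(i, j) ⟶ (i', j')` of `Ar I`. -/
abbrev hom {i j i' j' : I} (h : i ≤ j) (h' : i' ≤ j') (hi : i ≤ i') (hj : j ≤ j') :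
    mk i j h ⟶ mk i' j' h' :=
  homOfLE (show mk i j h ≤ mk i' j' h' from ⟨hi, hj⟩)

/-- The functor `Ar I ⥤ Ar J`, `(i, j) ↦ (φ i, φ j)`, induced by a monotone map `φ`. -/
def map (φ : I →o J) : Ar I ⥤ Ar J :=
  Monotone.functor (f := fun p : Ar I => mk (φ p.1.1) (φ p.1.2) (φ.monotone p.2))
    fun _ _ h => ⟨φ.monotone h.1, φ.monotone h.2⟩

end Ar

variable (A : Type u) [Category.{v} A]

/-- A functor `F : Ar I ⥤ A` is a *gap complex* if each `F (i, i)` is a zero object and for all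
`i ≤ j ≤ k` the square
```
  F (i, j) ---> F (i, k)
     |             |
     v             v
  F (j, j) ---> F (j, k)
```
is both a pushout and a pullback. For `A` abelian the latter says that the sequence
`0 ⟶ F (i, j) ⟶ F (i, k) ⟶ F (j, k) ⟶ 0` is exact. -/
structure IsGapComplex {I : Type} [LinearOrder I] (F : Ar I ⥤ A) : Prop where
  isZero : ∀ i : I, IsZero (F.obj (Ar.mk i i le_rfl))
  bicartesianSq : ∀ (i j k : I) (hij : i ≤ j) (hjk : j ≤ k),
    BicartesianSq
      (F.map (Ar.hom hij (hij.trans hjk) le_rfl hjk))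
      (F.map (Ar.hom hij le_rfl hij le_rfl))
      (F.map (Ar.hom (hij.trans hjk) hjk hij le_rfl))
      (F.map (Ar.hom le_rfl hjk le_rfl hjk))

/-- `Gap(I, A)`: the full subcategory of `Fun(Ar I, A)` on the gap complexes. -/
abbrev Gap (I : Type) [LinearOrder I] :=
  ObjectProperty.FullSubcategory (fun F : Ar I ⥤ A => IsGapComplex A F)

variable {A} in
/-- Precomposition with `Ar φ` preserves gap complexes. -/
theorem IsGapComplex.precomp {I J : Type} [LinearOrder I] [LinearOrder J] {F : Ar J ⥤ A}
    (hF : IsGapComplex A F) (φ : I →o J) : IsGapComplex A (Ar.map φ ⋙ F) where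
  isZero i := hF.isZero (φ i)
  bicartesianSq i j k hij hjk :=
    hF.bicartesianSq (φ i) (φ j) (φ k) (φ.monotone hij) (φ.monotone hjk)

/-- The functor `Gap(J, A) ⥤ Gap(I, A)`, `F ↦ F ∘ Ar φ`. -/
def Gap.restrict {I J : Type} [LinearOrder I] [LinearOrder J] (φ : I →o J) :
    Gap A J ⥤ Gap A I :=
  ObjectProperty.lift _
    (ObjectProperty.ι _ ⋙ (Functor.whiskeringLeft (Ar I) (Ar J) A).obj (Ar.map φ))
    fun F => F.property.precomp φ

/-- Waldhausen's `S_•`-construction of an abelian category `A`: the simplicial groupoid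
`[n] ↦ Gap([n], A)^eq`, the maximal subgroupoid of the category of gap complexes. -/
def waldhausenS : SimplexCategoryᵒᵖ ⥤ Grpd.{v, max u v} where
  obj n := Grpd.of (Core (Gap A (Fin (n.unop.len + 1))))
  map α := (Gap.restrict A α.unop.toOrderHom).core
  map_id _ := rfl
  map_comp _ _ := rfl

end DecompositionSpace

/-! A gap complex on a finite chain amounts to the filtration of its value `E` at the pair of
end-points `(o, t)` by the subobjects `F (o, j)`; the other values are the quotients `F (o, j) / F
(o, i)`. Pushing an active `g` out along an inert `f` replaces the interval `[f 0, f n]` of `[m]` by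
`[q]`. A point of the homotopy pullback is thus a filtration of `E` indexed by `[m]` together with a
filtration, indexed by `[q]`, of its subquotient `F (f 0, f n)`. Taking preimages in `F (0, f n)`
turns the latter into subobjects of `E` that refine the former, and the combined chain is indexed by
`[p]`.

Essential surjectivity is this construction (`exists_gap_of_iso`), recognised by
`exists_iso_quotients`. Faithfulness is `natTrans_ext`; fullness is `exists_iso_of_restrict`, where
the pullback squares of `IsGapComplex.isPullback` glue the maps. The pushout in `Δ` is never
computed: only the joint surjectivity of its legs and its mapping property into chains of a partial
order are used. -/

namespace DecompositionSpace

/-! ### Exactness lemmas in abelian categories. -/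

section Abelian

variable {A : Type u} [Category.{v} A] [Abelian A]

/-- In an abelian category, a pushout square along a monomorphism is a pullback square. -/
theorem isPullback_of_isPushout_of_mono {W X Y Z : A} {f : W ⟶ X} {g : W ⟶ Y} {h : X ⟶ Z}
    {i : Y ⟶ Z} (sq : IsPushout f g h i) [Mono f] : IsPullback f g h i := by
  -- A pushout square says that `W ⟶ X ⊞ Y ⟶ Z` is right exact; a monic first map makes `W` the
  -- kernel, which is the pullback property.
  have : Mono sq.shortComplex.f := by
    have : Mono (biprod.lift f (-g) ≫ biprod.fst) := by rwa [biprod.lift_fst]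
    exact mono_of_mono (biprod.lift f (-g)) biprod.fst
  have ex (s : PullbackCone h i) : ∃ k : s.pt ⟶ W, k ≫ f = s.fst ∧ k ≫ g = s.snd := by
    have hs : biprod.lift s.fst (-s.snd) ≫ biprod.desc h i = 0 := by
      rw [biprod.lift_desc, Preadditive.neg_comp, s.condition, add_neg_cancel]
    obtain ⟨k, hk⟩ : ∃ k : s.pt ⟶ W, k ≫ biprod.lift f (-g) = biprod.lift s.fst (-s.snd) :=
      ⟨_, sq.exact_shortComplex.lift_f _ hs⟩
    refine ⟨k, ?_, ?_⟩
    · simpa only [Category.assoc, biprod.lift_fst] using hk =≫ biprod.fst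
    · simpa only [Category.assoc, biprod.lift_snd, Preadditive.comp_neg, neg_inj] using
        hk =≫ biprod.snd
  choose k hk₁ hk₂ using ex
  exact ⟨sq.toCommSq, ⟨PullbackCone.IsLimit.mk sq.w k hk₁ hk₂
    fun s m h₁ _ => by rw [← cancel_mono f, h₁, hk₁]⟩⟩

/-- If `t` is a kernel of the epimorphism `r`, then `r` exhibits its target as `cokernel t`. -/
theorem isIso_cokernel_desc_of_isPullback {X₁ X₂ X₃ X₄ : A} {t : X₁ ⟶ X₂} {l : X₁ ⟶ X₃}
    {r : X₂ ⟶ X₄} {b : X₃ ⟶ X₄} (sq : IsPullback t l r b) [Epi r] (w : t ≫ r = 0) :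
    IsIso (cokernel.desc t r w) := by
  have : Mono (cokernel.desc t r w) := by
    -- A pullback square induces a monomorphism on cokernels, and it factors through the map in
    -- question.
    have h : cokernel.desc t r w ≫ cokernel.π b = cokernel.map _ _ _ _ sq.w := by
      ext; simp
    have := Abelian.mono_cokernel_map_of_isPullback sq
    rw [← h] at this
    exact mono_of_mono _ (cokernel.π b)
  have : Epi (cokernel.desc t r w) := epi_of_epi_fac (cokernel.π_desc t r w)
  exact isIso_of_mono_of_epi _

/-- The square exhibiting `cokernel f` as a pushout along a zero object. -/
theorem isPushout_cokernel {X Y Z : A} (f : X ⟶ Y) (hZ : IsZero Z) (g : X ⟶ Z)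
    (h : Z ⟶ cokernel f) : IsPushout f g (cokernel.π f) h := by
  refine ⟨⟨by simp [hZ.eq_zero_of_src h]⟩, ⟨PushoutCocone.IsColimit.mk _
    (fun s => cokernel.desc f s.inl ?_) ?_ ?_ ?_⟩⟩
  · rw [s.condition, hZ.eq_zero_of_src s.inr, comp_zero]
  · intro s; simp
  · intro s; exact hZ.eq_of_src _ _
  · intro s m h₁ _; ext; simpa using h₁

end Abelian

/-! ### Monomorphisms, epimorphisms and pullbacks in a gap complex. -/

section Gap

variable {A : Type u} [Category.{v} A] {I : Type} [LinearOrder I]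

namespace IsGapComplex

variable {F F' : Ar I ⥤ A} (hF : IsGapComplex A F) (hF' : IsGapComplex A F')

include hF

theorem mono_map (i j k : I) (hij : i ≤ j) (hjk : j ≤ k) :
    Mono (F.map (Ar.hom hij (hij.trans hjk) le_rfl hjk)) :=
  have sq := (hF.bicartesianSq i j k hij hjk).toIsPullback
  (MorphismProperty.monomorphisms A).of_isPullback sq.flip ((hF.isZero j).mono _)

theorem epi_map (i j k : I) (hij : i ≤ j) (hjk : j ≤ k) :
    Epi (F.map (Ar.hom (hij.trans hjk) hjk hij le_rfl)) :=
  have sq := (hF.bicartesianSq i j k hij hjk).toIsPushout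
  (MorphismProperty.epimorphisms A).of_isPushout sq ((hF.isZero j).epi _)

/-- Pasted onto the defining square of `(i', j, k)`, this square gives the defining square of `(i,
j, k)`, so pullbacks cancel. It says that `F (i, j)` is the preimage of `F (i', j)` in `F (i, k)`.
-/
theorem isPullback (i i' j k : I) (hi : i ≤ i') (hij : i' ≤ j) (hjk : j ≤ k) :
    IsPullback
      (F.map (Ar.hom (hi.trans hij) ((hi.trans hij).trans hjk) le_rfl hjk))
      (F.map (Ar.hom (hi.trans hij) hij hi le_rfl))
      (F.map (Ar.hom ((hi.trans hij).trans hjk) (hij.trans hjk) hi le_rfl))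
      (F.map (Ar.hom hij (hij.trans hjk) le_rfl hjk)) := by
  refine IsPullback.of_bot ?_ ?_ (hF.bicartesianSq i' j k hij hjk).toIsPullback
  · rw [← F.map_comp, ← F.map_comp]
    exact (hF.bicartesianSq i j k (hi.trans hij) hjk).toIsPullback
  · simp only [← F.map_comp]
    rfl

end IsGapComplex

end Gap

/-! ### Morphisms of gap complexes as morphisms of filtered objects. -/

section GapMorphisms

variable {A : Type u} [Category.{v} A] {I : Type} [LinearOrder I]
  {F F' : Ar I ⥤ A} (hF : IsGapComplex A F) (hF' : IsGapComplex A F')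
  {o t : I} (ho : ∀ i, o ≤ i) (ht : ∀ i, i ≤ t)

namespace IsGapComplex

include hF hF' ht in
/-- A morphism of gap complexes is determined by its component at the pair of end-points. -/
theorem natTrans_ext {γ γ' : F ⟶ F'}
    (h : γ.app (Ar.mk o t (ho t)) = γ'.app (Ar.mk o t (ho t))) : γ = γ' := by
  ext ⟨⟨i, j⟩, hij⟩
  -- `F (o, j)` surjects onto `F (i, j)` and `F' (o, j)` embeds into `F' (o, t)`, so the end-point
  -- component controls all others.
  have := hF.epi_map o i j (ho i) hij
  have := hF'.mono_map o j t (ho j) (ht j)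
  rw [← cancel_epi (F.map (Ar.hom ((ho i).trans hij) hij (ho i) le_rfl)), γ.naturality,
    γ'.naturality]
  congr 1
  rw [← cancel_mono (F'.map (Ar.hom (ho j) ((ho j).trans (ht j)) le_rfl (ht j))),
    ← γ.naturality, ← γ'.naturality, h]

include hF hF' in
/-- A morphism on the value at the pair of end-points that restricts to the values at all pairs
`(o, j)` extends to a morphism of gap complexes. -/
theorem exists_natTrans [HasZeroMorphisms A]
    (φ : F.obj (Ar.mk o t (ho t)) ⟶ F'.obj (Ar.mk o t (ho t)))
    (hφ : ∀ j, ∃ ψ : F.obj (Ar.mk o j (ho j)) ⟶ F'.obj (Ar.mk o j (ho j)),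
      ψ ≫ F'.map (Ar.hom (ho j) (ho t) le_rfl (ht j)) =
        F.map (Ar.hom (ho j) (ho t) le_rfl (ht j)) ≫ φ) :
    ∃ γ : F ⟶ F', γ.app (Ar.mk o t (ho t)) = φ := by
  choose ψ hψ using hφ
  have nat (i j : I) (hij : i ≤ j) : F.map (Ar.hom (ho i) (ho j) le_rfl hij) ≫ ψ j =
      ψ i ≫ F'.map (Ar.hom (ho i) (ho j) le_rfl hij) := by
    have := hF'.mono_map o j t (ho j) (ht j)
    rw [← cancel_mono (F'.map (Ar.hom (ho j) (ho t) le_rfl (ht j))), Category.assoc,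
      Category.assoc, hψ, ← F.map_comp_assoc, ← F'.map_comp]
    exact (hψ i).symm
  have comp (x : Ar I) : ∃ c : F.obj x ⟶ F'.obj x,
      F.map (homOfLE (show Ar.mk o x.1.2 (ho _) ≤ x from ⟨ho _, le_rfl⟩)) ≫ c =
        ψ x.1.2 ≫ F'.map (homOfLE (show Ar.mk o x.1.2 (ho _) ≤ x from ⟨ho _, le_rfl⟩)) := by
    obtain ⟨⟨i, j⟩, hij⟩ := x
    have sq := (hF.bicartesianSq o i j (ho i) hij).toIsPushout
    -- `F (i, j)` is the cokernel of `F (o, i) ⟶ F (o, j)`. The map induced by `ψ j` descends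
    -- because `F' (o, i) ⟶ F' (i, j)` factors through the zero object `F' (i, i)`.
    refine ⟨sq.desc (ψ j ≫ F'.map (Ar.hom (ho j) hij (ho i) le_rfl)) 0 ?_, sq.inl_desc _ _ _⟩
    rw [comp_zero, reassoc_of% nat i j hij, ← F'.map_comp]
    have : F'.map (Ar.hom (ho i) (ho j) le_rfl hij ≫ Ar.hom (ho j) hij (ho i) le_rfl) =
        F'.map (Ar.hom (ho i) le_rfl (ho i) le_rfl) ≫
          F'.map (Ar.hom le_rfl hij le_rfl hij) := by
      rw [← F'.map_comp]; rfl
    rw [this, (hF'.isZero i).eq_zero_of_src (F'.map (Ar.hom le_rfl hij le_rfl hij)), comp_zero,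
      comp_zero]
  choose c hc using comp
  refine ⟨⟨c, ?_⟩, ?_⟩
  · intro x y f
    have := hF.epi_map o x.1.1 x.1.2 (ho _) x.2
    have hf := leOfHom f
    rw [← cancel_epi (F.map (Ar.hom (ho x.1.2) x.2 (ho _) le_rfl)), reassoc_of% hc x,
      ← F'.map_comp, ← F.map_comp_assoc]
    have h₁ : Ar.hom (ho x.1.2) x.2 (ho _) le_rfl ≫ f = Ar.hom (ho _) (ho _) le_rfl hf.2 ≫
      homOfLE (show Ar.mk o y.1.2 (ho _) ≤ y from ⟨ho _, le_rfl⟩) := rfl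
    rw [h₁, F.map_comp_assoc, hc y, reassoc_of% nat _ _ hf.2, ← F'.map_comp]
  · have h₁ := hc (Ar.mk o t (ho t))
    have h₂ := hψ t
    have := hF.epi_map o o t le_rfl (ho t)
    rw [← cancel_epi (F.map (Ar.hom (ho t) (ho t) le_rfl le_rfl))]
    exact h₁.trans h₂

include hF hF' in
/-- An isomorphism of the values at the pair of end-points that restricts to isomorphisms of the
values at all pairs `(o, j)` extends to an isomorphism of gap complexes. -/
theorem exists_iso [HasZeroMorphisms A]
    (φ : F.obj (Ar.mk o t (ho t)) ≅ F'.obj (Ar.mk o t (ho t)))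
    (hφ : ∀ j, ∃ ψ : F.obj (Ar.mk o j (ho j)) ≅ F'.obj (Ar.mk o j (ho j)),
      ψ.hom ≫ F'.map (Ar.hom (ho j) (ho t) le_rfl (ht j)) =
        F.map (Ar.hom (ho j) (ho t) le_rfl (ht j)) ≫ φ.hom) :
    ∃ γ : F ≅ F', γ.hom.app (Ar.mk o t (ho t)) = φ.hom := by
  obtain ⟨γ, hγ⟩ := exists_natTrans hF hF' ho ht φ.hom fun j => (hφ j).imp' Iso.hom fun _ h => h
  obtain ⟨γ', hγ'⟩ := exists_natTrans hF' hF ho ht φ.inv fun j => by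
    obtain ⟨ψ, h⟩ := hφ j
    refine ⟨ψ.inv, ?_⟩
    rw [Iso.inv_comp_eq, ← Category.assoc, h, Category.assoc, φ.hom_inv_id, Category.comp_id]
  exact ⟨⟨γ, γ', natTrans_ext hF hF ho ht (by simp [hγ, hγ']),
    natTrans_ext hF' hF' ho ht (by simp [hγ, hγ'])⟩, hγ⟩

end IsGapComplex

end GapMorphisms

/-! ### The gap complex of a filtration. -/

section GapOfFiltration

variable {A : Type u} [Category.{v} A] [Abelian A] {I J : Type} [LinearOrder I] [LinearOrder J]

/-- The functor `(i, j) ↦ U j / U i` associated with a functor `U : I ⥤ A`. -/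
noncomputable def quotients (U : I ⥤ A) : Ar I ⥤ A where
  obj x := cokernel (U.map (homOfLE x.2))
  map {x y} f := cokernel.map _ _ (U.map (homOfLE (leOfHom f).1)) (U.map (homOfLE (leOfHom f).2))
    (by rw [← U.map_comp, ← U.map_comp]; rfl)
  map_id x := by
    ext
    rw [cokernel.π_desc, Category.comp_id]
    exact (congrArg (· ≫ _) (U.map_id _)).trans (Category.id_comp _)
  map_comp f g := by
    ext
    simp only [cokernel.π_desc, cokernel.π_desc_assoc, cokernel.map, Category.assoc,
      ← U.map_comp_assoc]
    rfl

/-- The projection of `U j` onto the value `U j / U i` of `quotients U` at `(i, j)`. -/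
noncomputable def toQuotients (U : I ⥤ A) (i j : I) (h : i ≤ j) :
    U.obj j ⟶ (quotients U).obj (Ar.mk i j h) :=
  cokernel.π _

instance (U : I ⥤ A) (i j : I) (h : i ≤ j) : Epi (toQuotients U i j h) :=
  inferInstanceAs (Epi (cokernel.π _))

theorem toQuotients_map (U : I ⥤ A) {i j i' j' : I} (h : i ≤ j) (h' : i' ≤ j') (hi : i ≤ i')
    (hj : j ≤ j') : toQuotients U i j h ≫ (quotients U).map (Ar.hom h h' hi hj) =
      U.map (homOfLE hj) ≫ toQuotients U i' j' h' :=
  cokernel.π_desc _ _ _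

/-- The third isomorphism theorem by pasting: `sq₀` presents each quotient as a pushout along a zero
object, and cancellation yields `sq₁`, then the required `sq₂`. Monomorphisms are stable under
pushout, so `sq₂` is also a pullback. -/
theorem isGapComplex_quotients (U : I ⥤ A) [∀ {i j : I} (f : i ⟶ j), Mono (U.map f)] :
    IsGapComplex A (quotients U) := by
  have isZero (i : I) : IsZero ((quotients U).obj (Ar.mk i i le_rfl)) :=
    isZero_cokernel_of_epi (U.map (𝟙 i))
  have sq₀ (i j : I) (h : i ≤ j) : IsPushout (U.map (homOfLE h)) (toQuotients U i i le_rfl)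
      (toQuotients U i j h) ((quotients U).map (Ar.hom le_rfl h le_rfl h)) :=
    isPushout_cokernel _ (isZero i) _ _
  refine ⟨isZero, fun i j k hij hjk => ?_⟩
  have sq₁ : IsPushout (U.map (homOfLE hjk)) (toQuotients U i j hij)
      (toQuotients U i k (hij.trans hjk))
      ((quotients U).map (Ar.hom hij (hij.trans hjk) le_rfl hjk)) := by
    refine IsPushout.of_left ?_ (toQuotients_map U _ _ _ _).symm (sq₀ i j hij)
    rw [← U.map_comp, ← Functor.map_comp]
    exact sq₀ i k (hij.trans hjk)
  have sq₂ : IsPushout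
      ((quotients U).map (Ar.hom hij (hij.trans hjk) le_rfl hjk))
      ((quotients U).map (Ar.hom hij le_rfl hij le_rfl))
      ((quotients U).map (Ar.hom (hij.trans hjk) hjk hij le_rfl))
      ((quotients U).map (Ar.hom le_rfl hjk le_rfl hjk)) := by
    refine IsPushout.of_top ?_ ?_ sq₁
    · have h₁ : U.map (homOfLE (le_refl k)) = 𝟙 _ := U.map_id k
      have h₂ : U.map (homOfLE (le_refl j)) = 𝟙 _ := U.map_id j
      rw [toQuotients_map, toQuotients_map, h₁, h₂, Category.id_comp, Category.id_comp]
      exact sq₀ j k hjk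
    · rw [← Functor.map_comp, ← Functor.map_comp]; rfl
  have : Mono ((quotients U).map (Ar.hom hij (hij.trans hjk) le_rfl hjk)) :=
    (MorphismProperty.monomorphisms A).of_isPushout sq₁.flip
      (inferInstance : Mono (U.map (homOfLE hjk)))
  exact BicartesianSq.of_isPullback_isPushout (isPullback_of_isPushout_of_mono sq₂) sq₂

/-- The projection of `U (g j)` onto the value `U (g j) / U (g i)` at `(i, j)` of the restriction of
`quotients U` along `g`. -/
noncomputable def toQuotientsRestrict (U : J ⥤ A) (g : I →o J) (i j : I) (h : i ≤ j) :
    U.obj (g j) ⟶ (Ar.map g ⋙ quotients U).obj (Ar.mk i j h) :=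
  toQuotients U (g i) (g j) (g.monotone h)

instance (U : J ⥤ A) (g : I →o J) (i j : I) (h : i ≤ j) : Epi (toQuotientsRestrict U g i j h) :=
  inferInstanceAs (Epi (toQuotients U _ _ _))

theorem toQuotientsRestrict_map (U : J ⥤ A) (g : I →o J) {i j i' j' : I} (h : i ≤ j)
    (h' : i' ≤ j') (hi : i ≤ i') (hj : j ≤ j') :
    toQuotientsRestrict U g i j h ≫ (Ar.map g ⋙ quotients U).map (Ar.hom h h' hi hj) =
      U.map (homOfLE (g.monotone hj)) ≫ toQuotientsRestrict U g i' j' h' :=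
  toQuotients_map U _ _ (g.monotone hi) (g.monotone hj)

/-- A filtration `U` whose restriction along `g` is the pullback along an epimorphism
`π : W ⟶ F (o, t)` of the filtration `F (o, -)` of `F (o, t)` recovers the gap complex `F`. -/
theorem exists_iso_quotients (U : J ⥤ A) [∀ {i j : J} (f : i ⟶ j), Mono (U.map f)]
    (g : I →o J) {F : Ar I ⥤ A} (hF : IsGapComplex A F) {o t : I} (ho : ∀ i, o ≤ i)
    (ht : ∀ i, i ≤ t) {W : A} (x : ∀ i, U.obj (g i) ⟶ W)
    (hx : ∀ (i j : I) (h : i ≤ j), U.map (homOfLE (g.monotone h)) ≫ x j = x i)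
    (π : W ⟶ F.obj (Ar.mk o t (ho t))) [Epi π]
    (sq : ∀ i, ∃ s, IsPullback (x i) s π (F.map (Ar.hom (ho i) (ho t) le_rfl (ht i)))) :
    ∃ γ : Ar.map g ⋙ quotients U ≅ F, ∀ i,
      toQuotientsRestrict U g o i (ho i) ≫ γ.hom.app (Ar.mk o i (ho i)) ≫
        F.map (Ar.hom (ho i) (ho t) le_rfl (ht i)) = x i ≫ π := by
  choose s sq using sq
  have nat (i j : I) (h : i ≤ j) : U.map (homOfLE (g.monotone h)) ≫ s j =
      s i ≫ F.map (Ar.hom (ho i) (ho j) le_rfl h) := by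
    have := hF.mono_map o j t (ho j) (ht j)
    rw [← cancel_mono (F.map (Ar.hom (ho j) (ho t) le_rfl (ht j))), Category.assoc, ← (sq j).w,
      reassoc_of% hx i j h, (sq i).w, Category.assoc, ← F.map_comp]
    rfl
  have epi (j : I) : Epi (s j) :=
    (MorphismProperty.epimorphisms A).of_isPullback (sq j) (inferInstanceAs (Epi π))
  -- Since `F (o, o)` is zero, this says that `U (g o)` is the kernel of `s j`; as `s j` is epi, `U
  -- (g j) / U (g o)` is `F (o, j)`.
  have sq' (j : I) : IsPullback (U.map (homOfLE (g.monotone (ho j)))) (s o) (s j)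
      (F.map (Ar.hom (ho o) (ho j) le_rfl (ho j))) := by
    refine IsPullback.of_right ?_ (nat o j (ho j)) (sq j)
    rw [hx o j (ho j), ← F.map_comp]
    exact sq o
  have w (j : I) : U.map (homOfLE (g.monotone (ho j))) ≫ s j = 0 := by
    rw [(sq' j).w, (hF.isZero o).eq_zero_of_src (F.map _), comp_zero]
  have iso (j : I) : ∃ ψ : (Ar.map g ⋙ quotients U).obj (Ar.mk o j (ho j)) ≅
      F.obj (Ar.mk o j (ho j)), toQuotientsRestrict U g o j (ho j) ≫ ψ.hom = s j :=
    have := epi j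
    have := isIso_cokernel_desc_of_isPullback (sq' j) (w j)
    ⟨@asIso _ _ _ _ (cokernel.desc _ (s j) (w j)) this, cokernel.π_desc _ _ _⟩
  choose ψ hψ using iso
  have hG := (isGapComplex_quotients U).precomp g
  have hψ' (j : I) : (ψ j).hom ≫ F.map (Ar.hom (ho j) (ho t) le_rfl (ht j)) =
      (Ar.map g ⋙ quotients U).map (Ar.hom (ho j) (ho t) le_rfl (ht j)) ≫ (ψ t).hom := by
    rw [← cancel_epi (toQuotientsRestrict U g o j (ho j)), reassoc_of% hψ j,
      ← Category.assoc, toQuotientsRestrict_map, Category.assoc, hψ, nat j t (ht j)]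
  obtain ⟨γ, hγ⟩ := hG.exists_iso hF ho ht (ψ t) fun j => ⟨ψ j, hψ' j⟩
  refine ⟨γ, fun i => ?_⟩
  rw [← γ.hom.naturality, hγ, ← hψ', reassoc_of% hψ i, (sq i).w]

end GapOfFiltration

/-! ### Gluing morphisms and objects along a square of linear orders. -/

section Gluing

variable {A : Type u} [Category.{v} A] {N M Q P : Type} [LinearOrder N] [LinearOrder M]
  [LinearOrder Q] [LinearOrder P] {f : N →o M} {g : N →o Q} {g' : M →o P} {f' : Q →o P}
  (w : ∀ i, g' (f i) = f' (g i))
  {n₀ n₁ : N} (hn : n₀ ≤ n₁) {m₀ m₁ : M} (hm₀ : ∀ i, m₀ ≤ i) (hm₁ : ∀ i, i ≤ m₁)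
  (hg₀ : ∀ i, g n₀ ≤ i) (hg₁ : ∀ i, i ≤ g n₁)

include hm₀ hm₁ hg₀ hg₁ in
/-- Morphisms between the restrictions of two gap complexes along the two legs of a square of
linear orders glue. -/
theorem exists_natTrans_of_restrict [HasZeroMorphisms A] {H H' : Ar P ⥤ A}
    (hH : IsGapComplex A H) (hH' : IsGapComplex A H')
    (hp₀ : ∀ i, g' m₀ ≤ i) (hp₁ : ∀ i, i ≤ g' m₁)
    (surj : ∀ j, (∃ k, g' k = j) ∨ ∃ l, f' l = j)
    (α : Ar.map g' ⋙ H ⟶ Ar.map g' ⋙ H') (β : Ar.map f' ⋙ H ⟶ Ar.map f' ⋙ H')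
    (hαβ : β.app (Ar.mk (g n₀) (g n₁) (g.monotone hn)) ≫
      H'.map (Ar.hom (f'.monotone (g.monotone hn)) (g'.monotone (f.monotone hn)) (w n₀).ge
        (w n₁).ge) =
      H.map (Ar.hom (f'.monotone (g.monotone hn)) (g'.monotone (f.monotone hn)) (w n₀).ge
        (w n₁).ge) ≫ α.app (Ar.mk (f n₀) (f n₁) (f.monotone hn))) :
    ∃ γ : H ⟶ H', Functor.whiskerLeft (Ar.map g') γ = α ∧
      Functor.whiskerLeft (Ar.map f') γ = β := by
  let a (k k' : M) (h : k ≤ k') : H.obj (Ar.mk (g' k) (g' k') (g'.monotone h)) ⟶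
      H'.obj (Ar.mk (g' k) (g' k') (g'.monotone h)) := α.app (Ar.mk k k' h)
  let b (l l' : Q) (h : l ≤ l') : H.obj (Ar.mk (f' l) (f' l') (f'.monotone h)) ⟶
      H'.obj (Ar.mk (f' l) (f' l') (f'.monotone h)) := β.app (Ar.mk l l' h)
  have ha {k k' l l' : M} (h : k ≤ k') (h' : l ≤ l') (hk : k ≤ l) (hk' : k' ≤ l') :
      H.map (Ar.hom (g'.monotone h) (g'.monotone h') (g'.monotone hk) (g'.monotone hk')) ≫
        a l l' h' = a k k' h ≫
      H'.map (Ar.hom (g'.monotone h) (g'.monotone h') (g'.monotone hk) (g'.monotone hk')) :=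
    α.naturality (Ar.hom h h' hk hk')
  have hb {k k' l l' : Q} (h : k ≤ k') (h' : l ≤ l') (hk : k ≤ l) (hk' : k' ≤ l') :
      H.map (Ar.hom (f'.monotone h) (f'.monotone h') (f'.monotone hk) (f'.monotone hk')) ≫
        b l l' h' = b k k' h ≫
      H'.map (Ar.hom (f'.monotone h) (f'.monotone h') (f'.monotone hk) (f'.monotone hk')) :=
    β.naturality (Ar.hom h h' hk hk')
  -- The equality `g' (f i) = f' (g i)` is only propositional; values at equal indices are compared
  -- by the structure maps of the inequalities in both directions.
  have hab : b (g n₀) (g n₁) (g.monotone hn) =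
      H.map (Ar.hom (f'.monotone (g.monotone hn)) (g'.monotone (f.monotone hn)) (w n₀).ge
        (w n₁).ge) ≫ a (f n₀) (f n₁) (f.monotone hn) ≫
      H'.map (Ar.hom (g'.monotone (f.monotone hn)) (f'.monotone (g.monotone hn)) (w n₀).le
        (w n₁).le) := by
    have h : b (g n₀) (g n₁) (g.monotone hn) ≫
        H'.map (Ar.hom (f'.monotone (g.monotone hn)) (g'.monotone (f.monotone hn)) (w n₀).ge
          (w n₁).ge) =
        H.map (Ar.hom (f'.monotone (g.monotone hn)) (g'.monotone (f.monotone hn)) (w n₀).ge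
          (w n₁).ge) ≫ a (f n₀) (f n₁) (f.monotone hn) := hαβ
    have h' := h =≫ H'.map (Ar.hom (g'.monotone (f.monotone hn)) (f'.monotone (g.monotone hn))
      (w n₀).le (w n₁).le)
    rw [Category.assoc, Category.assoc, ← H'.map_comp] at h'
    exact ((congrArg (b _ _ _ ≫ ·) (H'.map_id _)).trans (Category.comp_id _)).symm.trans h'
  obtain ⟨γ, hγ⟩ := hH.exists_natTrans hH' hp₀ hp₁ (a m₀ m₁ (hm₀ _)) (by
    intro j
    rcases surj j with ⟨k, rfl⟩ | ⟨l, rfl⟩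
    · exact ⟨a m₀ k (hm₀ k), (ha (hm₀ k) (hm₀ m₁) le_rfl (hm₁ k)).symm⟩
    -- For an index from `Q`, the target is a preimage under `H' (g' m₀, f' (g n₁)) ⟶ H' (f' (g n₀),
    -- f' (g n₁))`: `α` supplies the map `u` to the ambient object, `β` the map `v` to the
    -- subquotient's filtration.
    · have sq := hH'.isPullback (g' m₀) (f' (g n₀)) (f' l) (f' (g n₁)) (hp₀ _)
        (f'.monotone (hg₀ l)) (f'.monotone (hg₁ l))
      have hl : f' l ≤ g' (f n₁) := (f'.monotone (hg₁ l)).trans (w n₁).ge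
      let u := H.map (Ar.hom (hp₀ (f' l)) (hp₀ (g' (f n₁))) le_rfl hl) ≫ a m₀ (f n₁) (hm₀ _) ≫
        H'.map (Ar.hom (hp₀ (g' (f n₁))) (hp₀ (f' (g n₁))) le_rfl (w n₁).le)
      let v := H.map (Ar.hom (hp₀ (f' l)) (f'.monotone (hg₀ l)) (hp₀ _) le_rfl) ≫
        b (g n₀) l (hg₀ l)
      have huv : u ≫ H'.map (Ar.hom (hp₀ (f' (g n₁))) (f'.monotone (g.monotone hn)) (hp₀ _)
            le_rfl) =
          v ≫ H'.map (Ar.hom (f'.monotone (hg₀ l)) (f'.monotone (g.monotone hn)) le_rfl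
            (f'.monotone (hg₁ l))) := by
        have h₁ := ha (hm₀ (f n₁)) (f.monotone hn) (hm₀ (f n₀)) le_rfl =≫
          H'.map (Ar.hom (g'.monotone (f.monotone hn)) (f'.monotone (g.monotone hn)) (w n₀).le
            (w n₁).le)
        have h₂ := H.map (Ar.hom (hp₀ (f' l)) (hp₀ (g' (f n₁))) le_rfl hl) ≫= h₁
        simp only [u, v, Category.assoc, ← hb (hg₀ l) (g.monotone hn) le_rfl (hg₁ l), hab]
        simp only [Category.assoc, ← Functor.map_comp, ← Functor.map_comp_assoc] at h₂ ⊢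
        exact h₂.symm
      refine ⟨sq.lift u v huv, ?_⟩
      have h₁ := sq.lift_fst u v huv =≫
        H'.map (Ar.hom (hp₀ (f' (g n₁))) (hp₀ (g' m₁)) le_rfl (hp₁ _))
      have h₂ := H.map (Ar.hom (hp₀ (f' l)) (hp₀ (g' (f n₁))) le_rfl hl) ≫=
        ha (hm₀ (f n₁)) (hm₀ m₁) le_rfl (hm₁ _)
      simp only [u, Category.assoc, ← Functor.map_comp, ← Functor.map_comp_assoc] at h₁ h₂
      exact h₁.trans h₂.symm)
  have hγα : Functor.whiskerLeft (Ar.map g') γ = α :=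
    (hH.precomp g').natTrans_ext (hH'.precomp g') hm₀ hm₁ hγ
  refine ⟨γ, hγα, (hH.precomp f').natTrans_ext (hH'.precomp f') hg₀ hg₁ ?_⟩
  -- Agreement with `β` needs checking only at `(g n₀, g n₁)`, where `hab` expresses `β` through
  -- `α`.
  have hγ' : γ.app (Ar.mk (g' (f n₀)) (g' (f n₁)) (g'.monotone (f.monotone hn))) =
      a (f n₀) (f n₁) (f.monotone hn) :=
    NatTrans.congr_app hγα (Ar.mk (f n₀) (f n₁) (f.monotone hn))
  refine Eq.trans ?_ hab.symm
  rw [← hγ', ← γ.naturality, ← Functor.map_comp_assoc]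
  exact ((congrArg (· ≫ _) (H.map_id _)).trans (Category.id_comp _)).symm

include hm₀ hm₁ hg₀ hg₁ in
/-- Isomorphisms between the restrictions of two gap complexes along the two legs of a square of
linear orders glue. -/
theorem exists_iso_of_restrict [HasZeroMorphisms A] {H H' : Ar P ⥤ A}
    (hH : IsGapComplex A H) (hH' : IsGapComplex A H')
    (hp₀ : ∀ i, g' m₀ ≤ i) (hp₁ : ∀ i, i ≤ g' m₁)
    (surj : ∀ j, (∃ k, g' k = j) ∨ ∃ l, f' l = j)
    (α : Ar.map g' ⋙ H ≅ Ar.map g' ⋙ H') (β : Ar.map f' ⋙ H ≅ Ar.map f' ⋙ H')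
    (hαβ : β.hom.app (Ar.mk (g n₀) (g n₁) (g.monotone hn)) ≫
      H'.map (Ar.hom (f'.monotone (g.monotone hn)) (g'.monotone (f.monotone hn)) (w n₀).ge
        (w n₁).ge) =
      H.map (Ar.hom (f'.monotone (g.monotone hn)) (g'.monotone (f.monotone hn)) (w n₀).ge
        (w n₁).ge) ≫ α.hom.app (Ar.mk (f n₀) (f n₁) (f.monotone hn))) :
    ∃ γ : H ≅ H', Functor.whiskerLeft (Ar.map g') γ.hom = α.hom ∧
      Functor.whiskerLeft (Ar.map f') γ.hom = β.hom := by
  obtain ⟨γ, hα, hβ⟩ := exists_natTrans_of_restrict w hn hm₀ hm₁ hg₀ hg₁ hH hH' hp₀ hp₁ surj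
    α.hom β.hom hαβ
  have inv {X Y X' Y' : A} (b : X ≅ X') (a : Y ≅ Y') (h : X ⟶ Y) (h' : X' ⟶ Y')
      (c : b.hom ≫ h' = h ≫ a.hom) : b.inv ≫ h = h' ≫ a.inv := (CommSq.mk c).horiz_inv.w
  obtain ⟨γ', hα', -⟩ := exists_natTrans_of_restrict w hn hm₀ hm₁ hg₀ hg₁ hH' hH hp₀ hp₁ surj
    α.inv β.inv (inv (β.app (Ar.mk (g n₀) (g n₁) (g.monotone hn)))
      (α.app (Ar.mk (f n₀) (f n₁) (f.monotone hn))) (H.map (Ar.hom _ _ _ _))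
      (H'.map (Ar.hom _ _ _ _)) hαβ)
  refine ⟨⟨γ, γ', hH.natTrans_ext hH hp₀ hp₁ ?_, hH'.natTrans_ext hH' hp₀ hp₁ ?_⟩, hα, hβ⟩
  · have h := NatTrans.congr_app α.hom_inv_id (Ar.mk m₀ m₁ (hm₀ _))
    rwa [← hα, ← hα'] at h
  · have h := NatTrans.congr_app α.inv_hom_id (Ar.mk m₀ m₁ (hm₀ _))
    rwa [← hα, ← hα'] at h

/-- A subobject given as a pullback maps to the ambient object through any intermediate
monomorphism, by a leg of a pullback square. -/
theorem exists_lift_of_isPullback {E V W Y Z : A} (S : Subobject E) {p : V ⟶ W} (ι : W ⟶ E)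
    [Mono p] [Mono ι] (hS : S = Subobject.mk (p ≫ ι)) {s : V ⟶ Y} {π : W ⟶ Z} {k : Y ⟶ Z}
    (sq : IsPullback p s π k) :
    ∃ x : (S : A) ⟶ W, x ≫ ι = S.arrow ∧ ∃ s, IsPullback x s π k := by
  subst hS
  refine ⟨(Subobject.underlyingIso (p ≫ ι)).hom ≫ p, by simp,
    (Subobject.underlyingIso (p ≫ ι)).hom ≫ s, ?_⟩
  exact sq.of_iso (Subobject.underlyingIso (p ≫ ι)).symm (Iso.refl _) (Iso.refl _) (Iso.refl _)
    (by simp) (by simp) (by simp) (by simp)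

include hm₀ hm₁ hg₀ hg₁ in
/-- Two gap complexes that agree on `N` are, up to isomorphism, restrictions of a gap complex on
`P`, provided that monotone maps from `P` to a partial order can be constructed by gluing. -/
theorem exists_gap_of_iso [Abelian A]
    (hn₀ : ∀ i, n₀ ≤ i) (hn₁ : ∀ i, i ≤ n₁) (hf : ∀ k, k ≤ f n₀ ∨ f n₁ ≤ k ∨ ∃ i, f i = k)
    (desc : ∀ (X : Type max u v) [PartialOrder X] (S : M →o X) (R : Q →o X),
      (∀ i, S (f i) = R (g i)) → (∀ k l, S k ≤ R l ∨ R l ≤ S k) →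
        ∃ T : P →o X, (∀ k, T (g' k) = S k) ∧ ∀ l, T (f' l) = R l)
    {F : Ar M ⥤ A} {G : Ar Q ⥤ A} (hF : IsGapComplex A F) (hG : IsGapComplex A G)
    (θ : Ar.map g ⋙ G ≅ Ar.map f ⋙ F) :
    ∃ (H : Ar P ⥤ A) (_ : IsGapComplex A H) (β : Ar.map f' ⋙ H ≅ G) (α : Ar.map g' ⋙ H ≅ F),
      β.hom.app (Ar.mk (g n₀) (g n₁) (g.monotone hn)) ≫ θ.hom.app (Ar.mk n₀ n₁ hn) =
      H.map (Ar.hom (f'.monotone (g.monotone hn)) (g'.monotone (f.monotone hn)) (w n₀).ge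
        (w n₁).ge) ≫ α.hom.app (Ar.mk (f n₀) (f n₁) (f.monotone hn)) := by
  let E := F.obj (Ar.mk m₀ m₁ (hm₀ _))
  let c (k : M) : F.obj (Ar.mk m₀ k (hm₀ k)) ⟶ E := F.map (Ar.hom (hm₀ k) (hm₀ m₁) le_rfl (hm₁ k))
  have (k : M) : Mono (c k) := hF.mono_map _ _ _ (hm₀ k) (hm₁ k)
  let S : M →o Subobject E := ⟨fun k => Subobject.mk (c k), fun k k' h =>
    Subobject.mk_le_mk_of_comm (F.map (Ar.hom (hm₀ k) (hm₀ k') le_rfl h))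
      (F.map_comp _ _).symm⟩
  let d (l : Q) : G.obj (Ar.mk (g n₀) l (hg₀ l)) ⟶ G.obj (Ar.mk (g n₀) (g n₁) (hg₀ _)) :=
    G.map (Ar.hom (hg₀ l) (hg₀ _) le_rfl (hg₁ l))
  have (l : Q) : Mono (d l) := hG.mono_map _ _ _ (hg₀ l) (hg₁ l)
  let q : F.obj (Ar.mk m₀ (f n₁) (hm₀ _)) ⟶ F.obj (Ar.mk (f n₀) (f n₁) (f.monotone hn)) :=
    F.map (Ar.hom (hm₀ _) (f.monotone hn) (hm₀ _) le_rfl)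
  have : Epi q := hF.epi_map _ _ _ _ _
  let θ' (i j : N) (h : i ≤ j) : F.obj (Ar.mk (f i) (f j) (f.monotone h)) ≅
      G.obj (Ar.mk (g i) (g j) (g.monotone h)) := (θ.app (Ar.mk i j h)).symm
  let π := q ≫ (θ' n₀ n₁ hn).hom
  -- `R l` is the preimage of `G (g n₀, l)` in `F (m₀, f n₁)`, viewed in `E`.
  let R : Q →o Subobject E := ⟨fun l => Subobject.mk (pullback.fst π (d l) ≫ c (f n₁)),
    fun l l' h => Subobject.mk_le_mk_of_comm
      (pullback.lift (pullback.fst π (d l))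
        (pullback.snd π (d l) ≫ G.map (Ar.hom (hg₀ l) (hg₀ l') le_rfl h))
        (by
          rw [Category.assoc, ← G.map_comp]
          exact pullback.condition))
      (by rw [pullback.lift_fst_assoc])⟩
  have hSR (i : N) : S (f i) = R (g i) := by
    have sq := hF.isPullback m₀ (f n₀) (f i) (f n₁) (hm₀ _) (f.monotone (hn₀ i))
      (f.monotone (hn₁ i))
    have sq' : IsPullback
        (F.map (Ar.hom (f.monotone (hn₀ i)) (f.monotone hn) le_rfl (f.monotone (hn₁ i))))
        (θ' n₀ i (hn₀ i)).hom (θ' n₀ n₁ hn).hom (d (g i)) :=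
      IsPullback.of_vert_isIso ⟨θ.inv.naturality (Ar.hom (hn₀ i) hn le_rfl (hn₁ i))⟩
    have sq'' : IsPullback (F.map (Ar.hom (hm₀ (f i)) (hm₀ (f n₁)) le_rfl (f.monotone (hn₁ i))))
        _ π (d (g i)) := sq.paste_vert sq'
    refine Subobject.mk_eq_mk_of_comm _ _ sq''.isoPullback ?_
    exact (sq''.isoPullback_hom_fst_assoc (c (f n₁))).trans (F.map_comp _ _).symm
  -- All `R l` lie between `S (f n₀)` and `S (f n₁)`, and by `hf` any `S k` strictly inside that
  -- range of indices is itself some `R (g i)`.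
  have total (k : M) (l : Q) : S k ≤ R l ∨ R l ≤ S k := by
    rcases hf k with h | h | ⟨i, rfl⟩
    · exact .inl ((S.monotone h).trans ((hSR n₀).le.trans (R.monotone (hg₀ l))))
    · exact .inr ((R.monotone (hg₁ l)).trans ((hSR n₁).ge.trans (S.monotone h)))
    · rw [hSR]
      exact (le_total (g i) l).imp (fun h => R.monotone h) fun h => R.monotone h
  obtain ⟨T, hTS, hTR⟩ := desc (Subobject E) S R hSR total
  let U : P ⥤ A := T.monotone.functor ⋙ Subobject.underlying
  have hU {i j : P} (h : i ⟶ j) : U.map h ≫ (T j).arrow = (T i).arrow :=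
    Subobject.underlying_arrow _
  have {i j : P} (h : i ⟶ j) : Mono (U.map h) :=
    @mono_of_mono_fac _ _ _ _ _ _ _ _ (inferInstanceAs (Mono (T i).arrow)) (hU h)
  have hx (l : Q) : ∃ x : U.obj (f' l) ⟶ F.obj (Ar.mk m₀ (f n₁) (hm₀ _)),
      x ≫ c (f n₁) = (T (f' l)).arrow ∧ ∃ s, IsPullback x s π (d l) :=
    exists_lift_of_isPullback (T (f' l)) (c (f n₁)) (hTR l) (IsPullback.of_hasPullback π (d l))
  choose x hxc sqx using hx
  -- On `M` no subquotient is involved, so `exists_iso_quotients` applies with `π` the identity of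
  -- `E`.
  have hy (k : M) : ∃ s, IsPullback (T (g' k)).arrow s (𝟙 E) (c k) := by
    have sq : IsPullback (c k) (𝟙 _) (𝟙 E) (c k) := IsPullback.of_vert_isIso ⟨by simp⟩
    obtain ⟨y, hy, h⟩ := exists_lift_of_isPullback (T (g' k)) (𝟙 E)
      ((hTS k).trans (by simp only [Category.comp_id]; rfl)) sq
    rw [Category.comp_id] at hy
    exact hy ▸ h
  obtain ⟨β, hβ⟩ := exists_iso_quotients U f' hG hg₀ hg₁ x (fun l l' h => by
    rw [← cancel_mono (c (f n₁)), Category.assoc, hxc, hxc, hU]) π sqx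
  obtain ⟨α, hα⟩ := exists_iso_quotients U g' hF hm₀ hm₁ (W := E) (fun k => (T (g' k)).arrow)
    (fun k k' h => hU _) (𝟙 E) hy
  refine ⟨quotients U, isGapComplex_quotients U, β, α, ?_⟩
  have hα' : toQuotientsRestrict U g' m₀ (f n₁) (hm₀ _) ≫ α.hom.app (Ar.mk m₀ (f n₁) (hm₀ _)) ≫
      c (f n₁) = (T (g' (f n₁))).arrow := (hα (f n₁)).trans (Category.comp_id _)
  have hβ' : toQuotientsRestrict U f' (g n₀) (g n₁) (g.monotone hn) ≫
      β.hom.app (Ar.mk (g n₀) (g n₁) (g.monotone hn)) = x (g n₁) ≫ π := by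
    rw [← hβ (g n₁)]
    exact congrArg (_ ≫ ·) ((Category.comp_id _).symm.trans
      (congrArg (_ ≫ ·) (G.map_id _).symm))
  have hα'' : toQuotientsRestrict U g' (f n₀) (f n₁) (f.monotone hn) ≫
      α.hom.app (Ar.mk (f n₀) (f n₁) (f.monotone hn)) =
      toQuotientsRestrict U g' m₀ (f n₁) (hm₀ _) ≫ α.hom.app (Ar.mk m₀ (f n₁) (hm₀ _)) ≫ q := by
    have h : toQuotientsRestrict U g' m₀ (f n₁) (hm₀ _) ≫ (Ar.map g' ⋙ quotients U).map
        (Ar.hom (hm₀ _) (f.monotone hn) (hm₀ _) le_rfl) =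
        toQuotientsRestrict U g' (f n₀) (f n₁) (f.monotone hn) :=
      (toQuotientsRestrict_map U g' (hm₀ (f n₁)) (f.monotone hn) (hm₀ _) le_rfl).trans
        ((congrArg (· ≫ _) (U.map_id _)).trans (Category.id_comp _))
    rw [← h, Category.assoc, α.hom.naturality]
  -- After the projection from `U (f' (g n₁))`, both sides become `x (g n₁) ≫ q`.
  refine (cancel_epi (toQuotientsRestrict U f' (g n₀) (g n₁) (g.monotone hn))).1 ?_
  refine ((Category.assoc _ _ _).symm.trans (congrArg (· ≫ _) hβ')).trans ?_
  have hθ : (θ' n₀ n₁ hn).hom ≫ θ.hom.app (Ar.mk n₀ n₁ hn) = 𝟙 _ := (θ' n₀ n₁ hn).hom_inv_id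
  have h₁ : toQuotientsRestrict U f' (g n₀) (g n₁) (g.monotone hn) ≫ (quotients U).map
      (Ar.hom (f'.monotone (g.monotone hn)) (g'.monotone (f.monotone hn)) (w n₀).ge (w n₁).ge) =
      U.map (homOfLE (w n₁).ge) ≫ toQuotientsRestrict U g' (f n₀) (f n₁) (f.monotone hn) :=
    toQuotients_map U _ _ (w n₀).ge (w n₁).ge
  have h₂ : U.map (homOfLE (w n₁).ge) ≫ toQuotientsRestrict U g' m₀ (f n₁) (hm₀ _) ≫
      α.hom.app (Ar.mk m₀ (f n₁) (hm₀ _)) = x (g n₁) := by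
    rw [← cancel_mono (c (f n₁)), Category.assoc, Category.assoc, hα', hU, hxc]
  have h₃ : (x (g n₁) ≫ π) ≫ θ.hom.app (Ar.mk n₀ n₁ hn) = x (g n₁) ≫ q :=
    (Category.assoc _ _ _).trans (congrArg (x (g n₁) ≫ ·) ((Category.assoc q _ _).trans
      ((congrArg (q ≫ ·) hθ).trans (Category.comp_id q))))
  have h₄ : x (g n₁) ≫ q = U.map (homOfLE (w n₁).ge) ≫
      toQuotientsRestrict U g' (f n₀) (f n₁) (f.monotone hn) ≫
        α.hom.app (Ar.mk (f n₀) (f n₁) (f.monotone hn)) := by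
    rw [hα'', ← h₂, Category.assoc, Category.assoc]
  exact (h₃.trans h₄).trans (((Category.assoc _ _ _).symm.trans
    (congrArg (· ≫ _) h₁.symm)).trans (Category.assoc _ _ _))

end Gluing

/-! ### Inert maps and pushouts in the simplex category. -/

section Simplex

variable {n m q p : SimplexCategory} {f : n ⟶ m} {g : n ⟶ q} {g' : m ⟶ p} {f' : q ⟶ p}

theorem IsInert.coe_apply (hf : IsInert f) (i : Fin (n.len + 1)) :
    (f.toOrderHom i : ℕ) = f.toOrderHom 0 + i := by
  induction i using Fin.induction with
  | zero => simp
  | succ i ih => rw [hf i, ih, Fin.val_succ, Fin.val_castSucc, add_assoc]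

/-- The image of an inert map is an interval. This is how inertness enters the proof: it makes the
glued subobjects a chain. -/
theorem IsInert.le_or_ge_or_exists (hf : IsInert f) (k : Fin (m.len + 1)) :
    k ≤ f.toOrderHom 0 ∨ f.toOrderHom (Fin.last n.len) ≤ k ∨ ∃ i, f.toOrderHom i = k := by
  by_cases h₀ : k ≤ f.toOrderHom 0
  · exact .inl h₀
  by_cases h₁ : f.toOrderHom (Fin.last n.len) ≤ k
  · exact .inr (.inl h₁)
  have h := hf.coe_apply (Fin.last n.len)
  rw [Fin.le_def, not_le] at h₀ h₁
  rw [Fin.val_last] at h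
  refine .inr (.inr ⟨⟨(k : ℕ) - f.toOrderHom 0, by omega⟩, Fin.ext ?_⟩)
  rw [hf.coe_apply]
  dsimp only
  omega

theorem toOrderHom_apply_of_comm (w : f ≫ g' = g ≫ f') (i : Fin (n.len + 1)) :
    g'.toOrderHom (f.toOrderHom i) = f'.toOrderHom (g.toOrderHom i) :=
  congrArg (fun h : n ⟶ p => h.toOrderHom i) w

/-- The legs of a pushout square in `Δ` are jointly surjective. -/
theorem exists_eq_of_isPushout (sq : IsPushout f g g' f') (j : Fin (p.len + 1)) :
    (∃ k, g'.toOrderHom k = j) ∨ ∃ l, f'.toOrderHom l = j := by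
  by_contra! h
  -- The indicators `a` of `[j, ∞)` and `b` of `(j, ∞)` differ only at `j`; if both legs missed `j`,
  -- they would agree on the legs, contradicting uniqueness.
  let a : p ⟶ SimplexCategory.mk 1 := SimplexCategory.Hom.mk
    ⟨fun i => if j ≤ i then 1 else 0, fun i i' hi => by
      dsimp only
      split_ifs with h₁ h₂
      · exact le_rfl
      · exact absurd (h₁.trans hi) h₂
      · exact Fin.zero_le _
      · exact le_rfl⟩
  let b : p ⟶ SimplexCategory.mk 1 := SimplexCategory.Hom.mk
    ⟨fun i => if j < i then 1 else 0, fun i i' hi => by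
      dsimp only
      split_ifs with h₁ h₂
      · exact le_rfl
      · exact absurd (h₁.trans_le hi) h₂
      · exact Fin.zero_le _
      · exact le_rfl⟩
  have hab (i : Fin (p.len + 1)) (hi : i ≠ j) : a.toOrderHom i = b.toOrderHom i :=
    if_congr ⟨fun h => lt_of_le_of_ne h hi.symm, le_of_lt⟩ rfl rfl
  have eq : a = b := sq.hom_ext
    (SimplexCategory.Hom.ext _ _ (OrderHom.ext _ _ (funext fun k => hab _ (h.1 k))))
    (SimplexCategory.Hom.ext _ _ (OrderHom.ext _ _ (funext fun l => hab _ (h.2 l))))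
  have : a.toOrderHom j = b.toOrderHom j := by rw [eq]
  have h₁ : a.toOrderHom j = 1 := if_pos le_rfl
  have h₀ : b.toOrderHom j = 0 := if_neg (lt_irrefl j)
  rw [h₁, h₀] at this
  exact one_ne_zero this

/-- A pushout square in `Δ` has the universal property of a pushout for monotone maps to a
partial order with totally ordered joint image. -/
theorem exists_orderHom_of_isPushout (sq : IsPushout f g g' f') {X : Type*} [PartialOrder X]
    (S : Fin (m.len + 1) →o X) (R : Fin (q.len + 1) →o X)
    (w : ∀ i, S (f.toOrderHom i) = R (g.toOrderHom i)) (total : ∀ k l, S k ≤ R l ∨ R l ≤ S k) :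
    ∃ T : Fin (p.len + 1) →o X, (∀ k, T (g'.toOrderHom k) = S k) ∧
      ∀ l, T (f'.toOrderHom l) = R l := by
  classical
  -- The joint image is a finite nonempty chain, hence isomorphic to an object of `Δ`, where the
  -- pushout property applies.
  let C := ↥(Set.range S ∪ Set.range R)
  let S' : Fin (m.len + 1) →o C := ⟨fun k => ⟨S k, .inl ⟨k, rfl⟩⟩, fun _ _ h => S.monotone h⟩
  let R' : Fin (q.len + 1) →o C := ⟨fun l => ⟨R l, .inr ⟨l, rfl⟩⟩, fun _ _ h => R.monotone h⟩
  let : LinearOrder C :=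
    { (inferInstance : PartialOrder C) with
      le_total := by
        rintro ⟨_, ⟨k, rfl⟩ | ⟨l, rfl⟩⟩ ⟨_, ⟨k', rfl⟩ | ⟨l', rfl⟩⟩
        · exact (le_total k k').imp (fun h => S.monotone h) fun h => S.monotone h
        · exact total k l'
        · exact (total k' l).symm
        · exact (le_total l l').imp (fun h => R.monotone h) fun h => R.monotone h
      toDecidableLE := Classical.decRel _ }
  have : Fintype C := Fintype.ofFinite _
  obtain ⟨k, hk⟩ : ∃ k, Fintype.card C = k + 1 :=
    Nat.exists_eq_succ_of_ne_zero (Fintype.card_pos_iff.2 ⟨S' 0⟩).ne'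
  let e := monoEquivOfFin C hk
  let s : m ⟶ SimplexCategory.mk k :=
    SimplexCategory.Hom.mk ((e.symm : C →o Fin (k + 1)).comp S')
  let r : q ⟶ SimplexCategory.mk k :=
    SimplexCategory.Hom.mk ((e.symm : C →o Fin (k + 1)).comp R')
  have hsr : f ≫ s = g ≫ r := SimplexCategory.Hom.ext _ _ (OrderHom.ext _ _
    (funext fun i => congrArg e.symm (Subtype.ext (w i))))
  let T := (sq.desc s r hsr).toOrderHom
  refine ⟨(OrderHom.Subtype.val _).comp ((e : Fin (k + 1) →o C).comp T), fun i => ?_, fun i => ?_⟩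
  · have h : T (g'.toOrderHom i) = e.symm (S' i) :=
      congrArg (fun h : m ⟶ _ => h.toOrderHom i) (sq.inl_desc s r hsr)
    change (e (T (g'.toOrderHom i)) : X) = S i
    rw [h, e.apply_symm_apply]
    rfl
  · have h : T (f'.toOrderHom i) = e.symm (R' i) :=
      congrArg (fun h : q ⟶ _ => h.toOrderHom i) (sq.inr_desc s r hsr)
    change (e (T (f'.toOrderHom i)) : X) = R i
    rw [h, e.apply_symm_apply]
    rfl

/-- Since `g 0 = 0`, the least value `f' 0` of the other leg is `g' (f 0)`; joint surjectivity does
the rest. -/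
theorem toOrderHom_zero_le (sq : IsPushout f g g' f') (hg : IsActive g) (i : Fin (p.len + 1)) :
    g'.toOrderHom 0 ≤ i := by
  rcases exists_eq_of_isPushout sq i with ⟨k, rfl⟩ | ⟨l, rfl⟩
  · exact g'.toOrderHom.monotone (Fin.zero_le _)
  · calc g'.toOrderHom 0 ≤ g'.toOrderHom (f.toOrderHom 0) :=
        g'.toOrderHom.monotone (Fin.zero_le _)
      _ = f'.toOrderHom 0 := by rw [toOrderHom_apply_of_comm sq.w, hg.1]
      _ ≤ _ := f'.toOrderHom.monotone (Fin.zero_le _)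

theorem le_toOrderHom_last (sq : IsPushout f g g' f') (hg : IsActive g) (i : Fin (p.len + 1)) :
    i ≤ g'.toOrderHom (Fin.last _) := by
  rcases exists_eq_of_isPushout sq i with ⟨k, rfl⟩ | ⟨l, rfl⟩
  · exact g'.toOrderHom.monotone (Fin.le_last _)
  · calc f'.toOrderHom l ≤ f'.toOrderHom (Fin.last _) := f'.toOrderHom.monotone (Fin.le_last _)
      _ = g'.toOrderHom (f.toOrderHom (Fin.last _)) := by
        rw [toOrderHom_apply_of_comm sq.w, hg.2]
      _ ≤ _ := g'.toOrderHom.monotone (Fin.le_last _)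

end Simplex

/-! ### The comparison functor is an equivalence. -/

section Waldhausen

variable {A : Type u} [Category.{v} A]

/-- The comparison functor carries an `eqToIso`; this turns its components into the structure maps
used in the gluing lemmas. -/
theorem eqToIso_core_restrict_app {I J : Type} [LinearOrder I] [LinearOrder J] {φ ψ : I →o J}
    (h : φ = ψ) (h' : (Gap.restrict A φ).core = (Gap.restrict A ψ).core) (H : Core (Gap A J))
    (i j : I) (hij : i ≤ j) :
    ((eqToIso h').hom.app H).iso.hom.hom.app (Ar.mk i j hij) =
      H.of.obj.map (Ar.hom (φ.monotone hij) (ψ.monotone hij) (DFunLike.congr_fun h i).le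
        (DFunLike.congr_fun h j).le) := by
  subst h
  exact (H.of.obj.map_id _).symm

/-- Waldhausen's `S_•`-construction of an abelian category is a decomposition space. -/
theorem isDecompositionSpace_waldhausenS (A : Type u) [Category.{v} A] [Abelian A] :
    IsDecompositionSpace (waldhausenS A) := by
  intro n m q p f g g' f' hf hg sq
  have w := toOrderHom_apply_of_comm sq.w
  have hn : (0 : Fin (n.len + 1)) ≤ Fin.last n.len := Fin.zero_le _
  have hm₀ (i : Fin (m.len + 1)) : 0 ≤ i := Fin.zero_le i
  have hm₁ (i : Fin (m.len + 1)) : i ≤ Fin.last m.len := Fin.le_last i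
  have hg₀ (i : Fin (q.len + 1)) : g.toOrderHom 0 ≤ i := hg.1 ▸ Fin.zero_le i
  have hg₁ (i : Fin (q.len + 1)) : i ≤ g.toOrderHom (Fin.last _) := hg.2 ▸ Fin.le_last i
  have hp₀ := toOrderHom_zero_le sq hg
  have hp₁ := le_toOrderHom_last sq hg
  have hw : f'.toOrderHom.comp g.toOrderHom = g'.toOrderHom.comp f.toOrderHom :=
    OrderHom.ext _ _ (funext fun i => (w i).symm)
  have e (H : Core (Gap A (Fin (p.len + 1)))) :=
    eqToIso_core_restrict_app hw (by rw [hw]) H 0 (Fin.last _) hn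
  -- The goals are faithfulness, fullness and essential surjectivity.
  refine @Functor.IsEquivalence.mk _ _ _ _ _ ⟨?_⟩ ⟨?_⟩ ⟨?_⟩
  · intro x y γ γ' h
    have h' := congrArg (fun φ => (φ.snd.iso.hom.hom.app
      (Ar.mk (0 : Fin (m.len + 1)) (Fin.last m.len) (hm₀ _)))) h
    exact Core.hom_ext (ObjectProperty.hom_ext _
      (x.of.property.natTrans_ext y.of.property hp₀ hp₁ h'))
  · intro x y φ
    have h := congrArg (fun φ => φ.iso.hom.hom.app
      (Ar.mk (0 : Fin (n.len + 1)) (Fin.last n.len) hn)) φ.w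
    obtain ⟨γ, hα, hβ⟩ := exists_iso_of_restrict w hn hm₀ hm₁ hg₀ hg₁ x.of.property
      y.of.property hp₀ hp₁ (exists_eq_of_isPushout sq)
      ((ObjectProperty.ι _).mapIso φ.snd.iso) ((ObjectProperty.ι _).mapIso φ.fst.iso)
      ((congrArg (_ ≫ ·) (e y).symm).trans (h.trans (congrArg (· ≫ _) (e x))))
    exact ⟨⟨ObjectProperty.isoMk _ γ⟩, CategoricalPullback.hom_ext
      (Core.hom_ext (ObjectProperty.hom_ext _ hβ)) (Core.hom_ext (ObjectProperty.hom_ext _ hα))⟩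
  · intro c
    obtain ⟨H, hH, β, α, h⟩ := exists_gap_of_iso w hn hm₀ hm₁ hg₀ hg₁ (fun i => Fin.zero_le i)
      (fun i => Fin.le_last i) hf.le_or_ge_or_exists
      (fun X _ S R => exists_orderHom_of_isPushout sq S R) c.snd.of.property c.fst.of.property
      ((ObjectProperty.ι _).mapIso c.iso.hom.iso)
    let x : Core (Gap A (Fin (p.len + 1))) := ⟨⟨H, hH⟩⟩
    refine ⟨x, ⟨CategoricalPullback.mkIso (Core.isoMk (ObjectProperty.isoMk _ β))
      (Core.isoMk (ObjectProperty.isoMk _ α)) ?_⟩⟩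
    -- Compatibility over `[n]` is an equality of morphisms of gap complexes, so the component at
    -- the end-points suffices.
    refine Core.hom_ext (ObjectProperty.hom_ext _
      ((hH.precomp (f'.toOrderHom.comp g.toOrderHom)).natTrans_ext
        (c.snd.of.property.precomp f.toOrderHom) (fun i => Fin.zero_le i)
        (fun i => Fin.le_last i) ?_))
    exact h.trans (congrArg (· ≫ _) (e x).symm)

end Waldhausen

end DecompositionSpace

theorem mainTheorem4 (A : Type u) [Category.{v} A] [Abelian A] :
    DecompositionSpace.IsDecompositionSpace (DecompositionSpace.waldhausenS A) :=
  DecompositionSpace.isDecompositionSpace_waldhausenS A
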